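/- Let $n\ge 2$ and let $\mathbb R^n$ carry the Minkowski inner product $\eta=\omega^1\otimes\omega^2+\omega^2\otimes\omega^1+\sum_{i\ge 3}\omega^i\otimes\omega^i$, where $(\omega^i)$ is dual to the standard basis $(k,l,m_1,\dots,m_{n-2})$. Let $GN\subset GL(n,\mathbb R)$ be the group of all $a$ with $a(k)\in\mathbb Rk$, with $\eta(aw,aw')=\eta(w,w')$ for all $w,w'\in k^\perp$, and with $\eta(ak,az)=\eta(k,z)$ for all $z\in\mathbb R^n$; let $\mathrm{Sim}(n-2)=\{a\in O(1,n-1):a(k)\in\mathbb Rk\}=GN\cap O(1,n-1)$. Let $M$ be a smooth $n$-dimensional manifold and let $P\to M$ be a $GN$-structure, i.e. a principal $GN$-subbundle of the frame bundle. Let $(\lambda,\Lambda,g^\perp,f)$ be the corresponding null-quadruple: $\lambda\subset\Lambda\subset TM$ are smooth distributions of dimension $1$ and $n-1$, $g^\perp$ is a smooth symmetric positive-definite bilinear form on $\Lambda/\lambda$, $f$ is a smooth nowhere vanishing one-form on $\lambda\otimes TM/\Lambda$ (that is, a linear functional on each fibre), and the frames in $P$ over $p$ are exactly the bases $(X,Y,Z_1,\dots,Z_{n-2})$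 of $T_pM$ such that $X\in\lambda_p$, $f(X\otimes[Y])=1$, and $Z_i\in\Lambda_p$ have classes forming a $g^\perp$-orthonormal basis of $\Lambda_p/\lambda_p$. Let $g$ be a Lorentzian metric belonging to $P$, i.e. there is a $\mathrm{Sim}(n-2)$-subbundle $Q\subset P$ with $g(uv,uw)=\eta(v,w)$ for all $u\in Q$ and $v,w\in\mathbb R^n$. Let $\lambda^*$ and $\Lambda^*$ be the annihilators in $T^*M$ of $\Lambda$ and $\lambda$ respectively; a covariant two-tensor is of type III if it lies in $\lambda^*\otimes\Lambda^*+\Lambda^*\otimes\lambda^*$. Let $\Gamma$ be a smooth linear connection on $M$ with associated affine connection $\nabla$. Then the following are equivalent: 1. $\Gamma$ is a connection in $P$ (its connection form, restricted to $P$, takes values in the Lie algebra of $GN$; equivalently, the local connection one-form with respect to every smooth local section of $P$ takes values in that Lie algebra). 2. $\nabla_Z\lambda\subset\lambda$, $\nabla_Z\Lambda\subset\Lambda$, and $\nabla_Z g$ is of type III, for all vector fields $Z$. 3. $\nabla$ restricts to affine connections on $\lambda$ and $\Lambda$, and $g^\perp$ and $f$ are covariantly constant with respect to the connections induced on $\Lambda/\lambda$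 and $\lambda\otimes TM/\Lambda$ respectively. -/

import Mathlib

open Bundle Manifold Set
open scoped Manifold ContDiff TensorProduct Topology

noncomputable section

namespace KundtGN

/-! ### The Minkowski inner product and the structure groups -/

/-- `ℝⁿ`; for `n = m + 2` its standard basis `e₀, e₁, e₂, …` is `k, l, m₁, …, m_{n-2}`. -/
abbrev Vec (n : ℕ) : Type := Fin n → ℝ

/-- The `j`-th vector of the standard basis of `ℝⁿ`. -/
def stdVec (n : ℕ) (j : Fin n) : Vec n := Pi.single j 1

/-- The Minkowski inner product `ω¹⊗ω² + ω²⊗ω¹ + ω³⊗ω³ + ⋯ + ωⁿ⊗ωⁿ`. -/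
def eta {m : ℕ} (v w : Vec (m + 2)) : ℝ :=
  v 0 * w 1 + v 1 * w 0 + ∑ i : Fin m, v i.succ.succ * w i.succ.succ

/-- The null vector `k`. -/
def kVec (m : ℕ) : Vec (m + 2) := stdVec (m + 2) 0

/-- Membership in the group `GN`. -/
def IsGN {m : ℕ} (a : Vec (m + 2) ≃L[ℝ] Vec (m + 2)) : Prop :=
  (∃ c : ℝ, a (kVec m) = c • kVec m) ∧
  (∀ w w' : Vec (m + 2), eta (kVec m) w = 0 → eta (kVec m) w' = 0 → eta (a w) (a w') = eta w w') ∧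
  (∀ z : Vec (m + 2), eta (a (kVec m)) (a z) = eta (kVec m) z)

theorem eta_smul_left {m : ℕ} (c : ℝ) (v w : Vec (m + 2)) : eta (c • v) w = c * eta v w := by
  simp only [eta, Pi.smul_apply, smul_eq_mul, mul_add, Finset.mul_sum]
  congr 1
  · ring
  · exact Finset.sum_congr rfl fun i _ => by ring

theorem kVec_ne_zero (m : ℕ) : kVec m ≠ 0 := by
  intro h
  have := congrFun h 0
  simp [kVec, stdVec] at this

theorem IsGN.scale_ne_zero {m : ℕ} {a : Vec (m + 2) ≃L[ℝ] Vec (m + 2)} {c : ℝ}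
    (hc : a (kVec m) = c • kVec m) : c ≠ 0 := by
  rintro rfl
  rw [zero_smul] at hc
  exact kVec_ne_zero m (a.injective (by rw [hc, map_zero]))

theorem IsGN.eta_kVec {m : ℕ} {a : Vec (m + 2) ≃L[ℝ] Vec (m + 2)} (ha : IsGN a)
    (w : Vec (m + 2)) : eta (kVec m) (a w) = 0 ↔ eta (kVec m) w = 0 := by
  obtain ⟨⟨c, hc⟩, -, h3⟩ := ha
  rw [← h3 w, hc, eta_smul_left]
  simp [IsGN.scale_ne_zero hc]

theorem IsGN.one (m : ℕ) : IsGN (1 : Vec (m + 2) ≃L[ℝ] Vec (m + 2)) :=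
  ⟨⟨1, (one_smul ℝ _).symm⟩, fun _ _ _ _ => rfl, fun _ => rfl⟩

theorem IsGN.mul {m : ℕ} {a b : Vec (m + 2) ≃L[ℝ] Vec (m + 2)} (ha : IsGN a) (hb : IsGN b) :
    IsGN (a * b) := by
  have hb' := hb
  have ha' := ha
  obtain ⟨⟨c, hc⟩, h2, h3⟩ := ha
  obtain ⟨⟨d, hd⟩, k2, k3⟩ := hb
  refine ⟨⟨d * c, ?_⟩, fun w w' hw hw' => ?_, fun z => ?_⟩
  · change a (b (kVec m)) = _
    rw [hd, map_smul, hc, smul_smul]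
  · change eta (a (b w)) (a (b w')) = _
    rw [h2 _ _ ((hb'.eta_kVec w).2 hw) ((hb'.eta_kVec w').2 hw'), k2 _ _ hw hw']
  · change eta (a (b (kVec m))) (a (b z)) = _
    rw [← k3 z, hd, map_smul, eta_smul_left, eta_smul_left, h3]

theorem IsGN.inv {m : ℕ} {a : Vec (m + 2) ≃L[ℝ] Vec (m + 2)} (ha : IsGN a) : IsGN a⁻¹ := by
  have ha' := ha
  obtain ⟨⟨c, hc⟩, h2, h3⟩ := ha
  have hc0 := IsGN.scale_ne_zero hc
  have hinv : ∀ w, a (a⁻¹ w) = w := fun w => a.apply_symm_apply w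
  have hk : a⁻¹ (kVec m) = c⁻¹ • kVec m := by
    apply a.injective
    rw [hinv, map_smul, hc, smul_smul, inv_mul_cancel₀ hc0, one_smul]
  refine ⟨⟨c⁻¹, hk⟩, fun w w' hw hw' => ?_, fun z => ?_⟩
  · have e1 : eta (kVec m) (a⁻¹ w) = 0 := by rw [← ha'.eta_kVec, hinv]; exact hw
    have e2 : eta (kVec m) (a⁻¹ w') = 0 := by rw [← ha'.eta_kVec, hinv]; exact hw'
    rw [← h2 _ _ e1 e2, hinv, hinv]
  · rw [hk, eta_smul_left, ← h3, hinv, hc, eta_smul_left, ← mul_assoc, inv_mul_cancel₀ hc0, one_mul]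

/-- The group `GN ⊆ GL(n, ℝ)`, `n = m + 2`. -/
def GN (m : ℕ) : Subgroup (Vec (m + 2) ≃L[ℝ] Vec (m + 2)) where
  carrier := {a | IsGN a}
  one_mem' := IsGN.one m
  mul_mem' := IsGN.mul
  inv_mem' := IsGN.inv

/-- The orthogonal group `O(1, n-1)` of the Minkowski inner product. -/
def lorentzGroup (m : ℕ) : Subgroup (Vec (m + 2) ≃L[ℝ] Vec (m + 2)) where
  carrier := {a | ∀ v w, eta (a v) (a w) = eta v w}
  one_mem' := fun _ _ => rfl
  mul_mem' := fun {a b} ha hb v w => (ha (b v) (b w)).trans (hb v w)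
  inv_mem' := fun {a} ha v w => by
    have hinv : ∀ w, a (a⁻¹ w) = w := fun w => a.apply_symm_apply w
    rw [← ha, hinv, hinv]

/-- The group `Sim(n-2) = {a ∈ O(1, n-1) : a k ∈ ℝ k}`. -/
def Sim (m : ℕ) : Subgroup (Vec (m + 2) ≃L[ℝ] Vec (m + 2)) where
  carrier := {a | a ∈ lorentzGroup m ∧ ∃ c : ℝ, a (kVec m) = c • kVec m}
  one_mem' := ⟨one_mem _, 1, (one_smul ℝ _).symm⟩
  mul_mem' := by
    rintro a b ⟨ha, c, hc⟩ ⟨hb, d, hd⟩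
    refine ⟨mul_mem ha hb, d * c, ?_⟩
    change a (b (kVec m)) = _
    rw [hd, map_smul, hc, smul_smul]
  inv_mem' := by
    rintro a ⟨ha, c, hc⟩
    refine ⟨inv_mem ha, c⁻¹, a.injective ?_⟩
    rw [map_smul, hc, smul_smul, inv_mul_cancel₀ (IsGN.scale_ne_zero hc), one_smul]
    exact a.apply_symm_apply _

/-- The Lie algebra of a (closed) subgroup `G` of `GL(n, ℝ)`: the endomorphisms `A` all of whose
exponentials `exp (t A)` belong to `G`. -/
def lieAlg {n : ℕ} (G : Subgroup (Vec n ≃L[ℝ] Vec n)) : Set (Vec n →L[ℝ] Vec n) :=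
  {A | ∀ t : ℝ, ∃ a ∈ G, (a : Vec n →L[ℝ] Vec n) = NormedSpace.exp (t • A)}

/-! ### Vector fields, frames, `G`-structures -/

section Manifold

variable {n : ℕ} {M : Type*} [TopologicalSpace M] [ChartedSpace (EuclideanSpace ℝ (Fin n)) M]
  [IsManifold (𝓡 n) ∞ M]

/-- The vector field `X` is smooth on `U`. -/
def SmoothFieldOn (X : ∀ x : M, TangentSpace (𝓡 n) x) (U : Set M) : Prop :=
  ContMDiffOn (𝓡 n) ((𝓡 n).prod 𝓘(ℝ, EuclideanSpace ℝ (Fin n))) ∞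
    (fun x => TotalSpace.mk' (EuclideanSpace ℝ (Fin n)) x (X x)) U

/-- The vector field `X` is differentiable at `x`. -/
def DiffFieldAt (X : ∀ x : M, TangentSpace (𝓡 n) x) (x : M) : Prop :=
  MDifferentiableAt (𝓡 n) ((𝓡 n).prod 𝓘(ℝ, EuclideanSpace ℝ (Fin n)))
    (fun x => TotalSpace.mk' (EuclideanSpace ℝ (Fin n)) x (X x)) x

/-- The real function `φ` is smooth on `U`. -/
def SmoothFunOn (n : ℕ) {M : Type*} [TopologicalSpace M]
    [ChartedSpace (EuclideanSpace ℝ (Fin n)) M] (φ : M → ℝ) (U : Set M) : Prop :=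
  ContMDiffOn (𝓡 n) 𝓘(ℝ, ℝ) ∞ φ U

/-- The frames at `x`, that is `GL(ℝⁿ, T_x M)`; the frame `u` is the basis `u e₀, u e₁, …`. -/
abbrev Frame (n : ℕ) {M : Type*} [TopologicalSpace M]
    [ChartedSpace (EuclideanSpace ℝ (Fin n)) M] (x : M) : Type _ :=
  Vec n ≃L[ℝ] TangentSpace (𝓡 n) x

/-- The family of frames `s` is smooth on `U`, i.e. it is a smooth section of the frame bundle
over `U`. Its values outside `U` play no role. -/
def SmoothFrameOn (s : ∀ x : M, Frame n x) (U : Set M) : Prop :=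
  ∀ j : Fin n, SmoothFieldOn (fun x => s x (stdVec n j)) U

variable (n M) in
/-- A `G`-structure on the `n`-dimensional manifold `M`: a subbundle of the frame bundle whose
fibres are orbits of the right action `u ↦ u ∘ a` of `G` (the action on frames is free) and which
admits smooth local sections about each point. -/
structure GStructure (G : Subgroup (Vec n ≃L[ℝ] Vec n)) where
  /-- The frames over `x` that belong to the structure. -/
  frames : ∀ x : M, Set (Frame n x)
  act_mem : ∀ (x : M), ∀ u ∈ frames x, ∀ a ∈ G, a.trans u ∈ frames x
  transitive : ∀ (x : M), ∀ u ∈ frames x, ∀ u' ∈ frames x, ∃ a ∈ G, u' = a.trans u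
  exists_section : ∀ x : M, ∃ U : Set M, IsOpen U ∧ x ∈ U ∧
    ∃ s : ∀ y : M, Frame n y, SmoothFrameOn s U ∧ ∀ y ∈ U, s y ∈ frames y

/-- `s` is a smooth section over `U` of the `G`-structure `P`. -/
def GStructure.IsSection {G : Subgroup (Vec n ≃L[ℝ] Vec n)} (P : GStructure n M G)
    (s : ∀ x : M, Frame n x) (U : Set M) : Prop :=
  SmoothFrameOn s U ∧ ∀ y ∈ U, s y ∈ P.frames y

/-! ### Linear connections -/

variable (n M) in
/-- Affine connections (covariant derivatives) on the tangent bundle;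
`∇ Y x v` is `∇_v Y` at the point `x`. -/
abbrev AffineConnection : Type _ :=
  CovariantDerivative (𝓡 n) (EuclideanSpace ℝ (Fin n)) (fun x : M => TangentSpace (𝓡 n) x)

/-- The local connection one-form at `x` of `∇` with respect to the local frame field `s` (the
pull-back by `s` of the connection form of the linear connection): the endomorphism `A(v)` of `ℝⁿ`
with `∇_v (s e_j) = s (A(v) e_j) = ∑ i, A(v)ⁱⱼ s e_i`. -/
def connectionForm (cov : AffineConnection n M) (s : ∀ x : M, Frame n x) (x : M)
    (v : TangentSpace (𝓡 n) x) : Vec n →L[ℝ] Vec n :=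
  LinearMap.toContinuousLinearMap ((Pi.basisFun ℝ (Fin n)).constr ℝ
    (fun j => (s x).symm (cov (fun y => s y (stdVec n j)) x v)))

/-- The linear connection belonging to `∇` is a connection in the `G`-structure `P`: its connection
form, restricted to `P`, takes values in the Lie algebra of `G`. On vertical vectors of `P` this is
automatic, and the other vectors tangent to `P` are tangent to local sections of `P`, so this says
that the local connection one-forms of all local sections of `P` are Lie algebra valued. -/
def IsConnectionIn {G : Subgroup (Vec n ≃L[ℝ] Vec n)} (cov : AffineConnection n M)
    (P : GStructure n M G) : Prop :=
  ∀ (U : Set M), IsOpen U → ∀ s : ∀ x : M, Frame n x, P.IsSection s U →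
    ∀ x ∈ U, ∀ v : TangentSpace (𝓡 n) x, connectionForm cov s x v ∈ lieAlg G

/-! ### Distributions -/

/-- A smooth distribution of rank `r`: locally spanned by `r` pointwise independent smooth
vector fields. -/
def IsSmoothDistribution (D : ∀ x : M, Submodule ℝ (TangentSpace (𝓡 n) x)) (r : ℕ) : Prop :=
  ∀ x : M, ∃ U : Set M, IsOpen U ∧ x ∈ U ∧
    ∃ X : Fin r → ∀ y : M, TangentSpace (𝓡 n) y,
      (∀ i, SmoothFieldOn (X i) U) ∧
      ∀ y ∈ U, LinearIndependent ℝ (fun i => X i y) ∧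
        Submodule.span ℝ (Set.range fun i => X i y) = D y

/-- The section `X` of the distribution `D` is smooth on `U`. -/
def SmoothSectionOn {D : ∀ x : M, Submodule ℝ (TangentSpace (𝓡 n) x)} (X : ∀ x : M, D x)
    (U : Set M) : Prop :=
  SmoothFieldOn (fun x => (X x : TangentSpace (𝓡 n) x)) U

/-- `∇_Z D ⊆ D` for all vector fields `Z`: `∇` restricts to a connection on `D`. -/
def Preserves (cov : AffineConnection n M)
    (D : ∀ x : M, Submodule ℝ (TangentSpace (𝓡 n) x)) : Prop :=
  ∀ (U : Set M), IsOpen U → ∀ X : ∀ x : M, D x, SmoothSectionOn X U →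
    ∀ x ∈ U, ∀ v : TangentSpace (𝓡 n) x, cov (fun y => (X y : TangentSpace (𝓡 n) y)) x v ∈ D x

/-- The restriction of `∇` to a preserved distribution `D`: `∇_v X ∈ D x` for a section `X` of `D`
that is smooth on an open set containing `x`. -/
def restrictConn {cov : AffineConnection n M}
    {D : ∀ x : M, Submodule ℝ (TangentSpace (𝓡 n) x)} (h : Preserves cov D)
    {U : Set M} (hU : IsOpen U) {X : ∀ x : M, D x} (hX : SmoothSectionOn X U)
    {x : M} (hx : x ∈ U) (v : TangentSpace (𝓡 n) x) : D x :=
  ⟨cov (fun y => (X y : TangentSpace (𝓡 n) y)) x v, h U hU X hX x hx v⟩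

/-! ### The covariant derivative of a two-tensor -/

/-- `(∇_v g)(Y, W) = v(g(Y, W)) - g(∇_v Y, W) - g(Y, ∇_v W)` at `x`, for a two-tensor field `g`,
vector fields `Y, W` and a tangent vector `v` at `x`. -/
def covDerivTensorAux (cov : AffineConnection n M)
    (g : ∀ x : M, TangentSpace (𝓡 n) x →L[ℝ] TangentSpace (𝓡 n) x →L[ℝ] ℝ)
    (x : M) (v : TangentSpace (𝓡 n) x) (Y W : ∀ x : M, TangentSpace (𝓡 n) x) : ℝ :=
  mvfderiv (𝓡 n) (fun y => g y (Y y) (W y)) x v - g x (cov Y x v) (W x) - g x (Y x) (cov W x v)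

variable (n M) in
/-- Smooth covariant tensor fields of rank two. -/
structure TwoTensor where
  /-- The bilinear form on each tangent space. -/
  toFun : ∀ x : M, TangentSpace (𝓡 n) x →L[ℝ] TangentSpace (𝓡 n) x →L[ℝ] ℝ
  smooth : ContMDiff (𝓡 n)
    ((𝓡 n).prod 𝓘(ℝ, EuclideanSpace ℝ (Fin n) →L[ℝ] EuclideanSpace ℝ (Fin n) →L[ℝ] ℝ)) ∞
    (fun x => TotalSpace.mk' (EuclideanSpace ℝ (Fin n) →L[ℝ] EuclideanSpace ℝ (Fin n) →L[ℝ] ℝ)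
      (E := fun x : M => TangentSpace (𝓡 n) x →L[ℝ] TangentSpace (𝓡 n) x →L[ℝ] ℝ) x (toFun x))

theorem TwoTensor.mdifferentiableAt_apply (g : TwoTensor n M) {x : M}
    {Y W : ∀ x : M, TangentSpace (𝓡 n) x} (hY : DiffFieldAt Y x) (hW : DiffFieldAt W x) :
    MDifferentiableAt (𝓡 n) 𝓘(ℝ, ℝ) (fun y => g.toFun y (Y y) (W y)) x := by
  have hg := (g.smooth.mdifferentiable (by simp)) x
  have := MDifferentiableAt.clm_bundle_apply₂ (F₃ := ℝ) (E₃ := Bundle.Trivial M ℝ)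
    (b := fun y : M => y) hg hY hW
  rw [mdifferentiableAt_section] at this
  simpa using this

theorem tensorial_covDerivTensorAux_left (cov : AffineConnection n M) (g : TwoTensor n M) {x : M}
    (v : TangentSpace (𝓡 n) x) (W : ∀ x : M, TangentSpace (𝓡 n) x) (hW : DiffFieldAt W x) :
    TensorialAt (𝓡 n) (EuclideanSpace ℝ (Fin n)) (covDerivTensorAux cov g.toFun x v · W) x where
  smul {f Y} hf hY := by
    have h := g.mdifferentiableAt_apply hY hW
    simp only [covDerivTensorAux, cov.isCovariantDerivativeOn.leibniz hY hf, Pi.smul_apply',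
      map_smul, _root_.smul_apply]
    have := congrArg (fun L => L v) (mvfderiv_fun_mul hf h)
    simp only [smul_eq_mul] at *
    rw [this]
    simp
    ring
  add {Y Y'} hY hY' := by
    have h := g.mdifferentiableAt_apply hY hW
    have h' := g.mdifferentiableAt_apply hY' hW
    simp only [covDerivTensorAux, cov.isCovariantDerivativeOn.add hY hY', Pi.add_apply,
      map_add, _root_.add_apply]
    have := congrArg (fun L => L v) (mvfderiv_fun_add h h')
    rw [this]
    simp
    ring

theorem tensorial_covDerivTensorAux_right (cov : AffineConnection n M) (g : TwoTensor n M) {x : M}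
    (v : TangentSpace (𝓡 n) x) (Y : ∀ x : M, TangentSpace (𝓡 n) x) (hY : DiffFieldAt Y x) :
    TensorialAt (𝓡 n) (EuclideanSpace ℝ (Fin n)) (covDerivTensorAux cov g.toFun x v Y ·) x where
  smul {f W} hf hW := by
    have h := g.mdifferentiableAt_apply hY hW
    simp only [covDerivTensorAux, cov.isCovariantDerivativeOn.leibniz hW hf, Pi.smul_apply',
      map_smul]
    have := congrArg (fun L => L v) (mvfderiv_fun_mul hf h)
    simp only [smul_eq_mul] at *
    rw [this]
    simp
    ring
  add {W W'} hW hW' := by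
    have h := g.mdifferentiableAt_apply hY hW
    have h' := g.mdifferentiableAt_apply hY hW'
    simp only [covDerivTensorAux, cov.isCovariantDerivativeOn.add hW hW', Pi.add_apply,
      map_add, _root_.add_apply]
    have := congrArg (fun L => L v) (mvfderiv_fun_add h h')
    rw [this]
    simp
    ring

/-- The covariant two-tensor `∇_v g` on `T_x M`. -/
def covDerivTensor (cov : AffineConnection n M) (g : TwoTensor n M) {x : M}
    (v : TangentSpace (𝓡 n) x) : TangentSpace (𝓡 n) x →L[ℝ] TangentSpace (𝓡 n) x →L[ℝ] ℝ :=
  TensorialAt.mkHom₂ (I := 𝓡 n) (F := EuclideanSpace ℝ (Fin n)) (F' := EuclideanSpace ℝ (Fin n))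
    (covDerivTensorAux cov g.toFun x v) x
    (tensorial_covDerivTensorAux_left cov g v) (tensorial_covDerivTensorAux_right cov g v)

theorem covDerivTensor_apply (cov : AffineConnection n M) (g : TwoTensor n M) {x : M}
    (v : TangentSpace (𝓡 n) x) {Y W : ∀ x : M, TangentSpace (𝓡 n) x}
    (hY : DiffFieldAt Y x) (hW : DiffFieldAt W x) :
    covDerivTensor cov g v (Y x) (W x) =
      mvfderiv (𝓡 n) (fun y => g.toFun y (Y y) (W y)) x v
        - g.toFun x (cov Y x v) (W x) - g.toFun x (Y x) (cov W x v) :=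
  TensorialAt.mkHom₂_apply _ _ hY hW

end Manifold

/-! ### Null-quadruples, metrics, boost order -/

section Null

variable {m : ℕ} {M : Type*} [TopologicalSpace M]
  [ChartedSpace (EuclideanSpace ℝ (Fin (m + 2))) M] [IsManifold (𝓡 (m + 2)) ∞ M]

variable (m M) in
/-- Lorentzian metrics on the manifold `M` of dimension `m + 2`: smooth symmetric two-tensor fields
that on each tangent space are isomorphic to the Minkowski inner product. -/
structure LorentzMetric extends TwoTensor (m + 2) M where
  symm : ∀ (x : M) (v w : TangentSpace (𝓡 (m + 2)) x), toFun x v w = toFun x w v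
  signature : ∀ x : M, ∃ u : Frame (m + 2) x, ∀ v w, toFun x (u v) (u w) = eta v w

/-- The metric `g` belongs to the `GN`-structure `P`: it is determined by a `Sim(n-2)`-subbundle `Q`
of `P`, i.e. the elements of `Q` are null-frames for `g`. -/
def LorentzMetric.BelongsTo (g : LorentzMetric m M) (P : GStructure (m + 2) M (GN m)) : Prop :=
  ∃ Q : GStructure (m + 2) M (Sim m), (∀ x, Q.frames x ⊆ P.frames x) ∧
    ∀ (x : M), ∀ u ∈ Q.frames x, ∀ v w, g.toFun x (u v) (u w) = eta v w

/-- The fibre at `x` of the quotient bundle `Λ/λ`. -/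
abbrev ScreenSpace (lam Lam : ∀ x : M, Submodule ℝ (TangentSpace (𝓡 (m + 2)) x)) (x : M) : Type :=
  Lam x ⧸ (lam x).submoduleOf (Lam x)

/-- The class in `Λ/λ` of an element of `Λ`. -/
abbrev screenClass {lam Lam : ∀ x : M, Submodule ℝ (TangentSpace (𝓡 (m + 2)) x)} {x : M}
    (w : Lam x) : ScreenSpace lam Lam x :=
  Submodule.Quotient.mk w

variable (m M) in
/-- Null-quadruples `(λ, Λ, g^⊥, f)` on the manifold `M` of dimension `n = m + 2`. -/
structure NullQuadruple where
  /-- The distribution `λ` of dimension one. -/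
  lam : ∀ x : M, Submodule ℝ (TangentSpace (𝓡 (m + 2)) x)
  /-- The distribution `Λ` of dimension `n - 1`. -/
  Lam : ∀ x : M, Submodule ℝ (TangentSpace (𝓡 (m + 2)) x)
  smooth_lam : IsSmoothDistribution lam 1
  smooth_Lam : IsSmoothDistribution Lam (m + 1)
  lam_le : ∀ x, lam x ≤ Lam x
  /-- The bilinear form `g^⊥` on `Λ/λ`. -/
  gPerp : ∀ x, ScreenSpace lam Lam x →ₗ[ℝ] ScreenSpace lam Lam x →ₗ[ℝ] ℝ
  gPerp_symm : ∀ x a b, gPerp x a b = gPerp x b a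
  gPerp_pos : ∀ x a, a ≠ 0 → 0 < gPerp x a a
  gPerp_smooth : ∀ U : Set M, IsOpen U → ∀ W W' : ∀ x, Lam x,
    SmoothSectionOn W U → SmoothSectionOn W' U →
    SmoothFunOn (m + 2) (fun x => gPerp x (screenClass (W x)) (screenClass (W' x))) U
  /-- The one-form `f` on the line bundle `λ ⊗ TM/Λ`. -/
  f : ∀ x, lam x ⊗[ℝ] (TangentSpace (𝓡 (m + 2)) x ⧸ Lam x) →ₗ[ℝ] ℝ
  f_ne_zero : ∀ x, f x ≠ 0
  f_smooth : ∀ U : Set M, IsOpen U → ∀ (X : ∀ x, lam x) (Y : ∀ x, TangentSpace (𝓡 (m + 2)) x),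
    SmoothSectionOn X U → SmoothFieldOn Y U →
    SmoothFunOn (m + 2) (fun x => f x (X x ⊗ₜ[ℝ] (Lam x).mkQ (Y x))) U

/-- The frames `(X, Y, Z_i)` at `x` determined by a null-quadruple: `X ∈ λ`, `f(X ⊗ [Y]) = 1`, and
the `Z_i` lie in `Λ` with classes forming an orthonormal basis of the `(n-2)`-dimensional space
`Λ/λ` with respect to `g^⊥`. -/
def NullQuadruple.frames (q : NullQuadruple m M) (x : M) : Set (Frame (m + 2) x) :=
  {u | ∃ (hX : u (stdVec (m + 2) 0) ∈ q.lam x)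
      (hZ : ∀ i : Fin m, u (stdVec (m + 2) i.succ.succ) ∈ q.Lam x),
      q.f x (⟨u (stdVec (m + 2) 0), hX⟩ ⊗ₜ[ℝ] (q.Lam x).mkQ (u (stdVec (m + 2) 1))) = 1 ∧
      ∀ i j : Fin m, q.gPerp x (screenClass ⟨u (stdVec (m + 2) i.succ.succ), hZ i⟩)
        (screenClass ⟨u (stdVec (m + 2) j.succ.succ), hZ j⟩) = if i = j then 1 else 0}

/-- The `GN`-structure `P` and the null-quadruple `q` correspond to each other. -/
def Corresponds (P : GStructure (m + 2) M (GN m)) (q : NullQuadruple m M) : Prop :=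
  ∀ x, P.frames x = q.frames x

/-- The filtration `T*M^{-1} = λ* ⊆ T*M^0 = Λ* ⊆ T*M^1 = T*M`, where `λ*` is the annihilator of `Λ`
and `Λ*` the annihilator of `λ`. -/
def NullQuadruple.cotangentFiltration (q : NullQuadruple m M) (x : M) :
    SignType → Submodule ℝ (Module.Dual ℝ (TangentSpace (𝓡 (m + 2)) x))
  | SignType.neg => (q.Lam x).dualAnnihilator
  | SignType.zero => (q.lam x).dualAnnihilator
  | SignType.pos => ⊤

/-- The covariant two-tensors at `x` of boost-order `s`: the sum of the spaces
`T*M^{s₁} ⊗ T*M^{s₂}` with `s₁, s₂ ∈ {-1, 0, 1}`, `s₁ + s₂ = s`. -/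
def NullQuadruple.boostOrder (q : NullQuadruple m M) (x : M) (s : ℤ) :
    Submodule ℝ (LinearMap.BilinForm ℝ (TangentSpace (𝓡 (m + 2)) x)) :=
  Submodule.span ℝ {B | ∃ s₁ s₂ : SignType, (s₁ : ℤ) + (s₂ : ℤ) = s ∧
    ∃ α ∈ q.cotangentFiltration x s₁, ∃ β ∈ q.cotangentFiltration x s₂,
      B = LinearMap.BilinForm.linMulLin α β}

/-- The covariant two-tensor `T` on `T_x M` is of type `III`, i.e. of boost-order `-1`. -/
def NullQuadruple.IsTypeIII (q : NullQuadruple m M) {x : M}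
    (T : TangentSpace (𝓡 (m + 2)) x →L[ℝ] TangentSpace (𝓡 (m + 2)) x →L[ℝ] ℝ) : Prop :=
  ∃ B ∈ q.boostOrder x (-1), ∀ v w, T v w = B v w

/-! ### Parallel `g^⊥` and `f` -/

/-- `g^⊥` is covariantly constant with respect to the connection `∇_v [W] = [∇_v W]` induced on
`Λ/λ`: `v(g^⊥([W], [W'])) = g^⊥(∇_v [W], [W']) + g^⊥([W], ∇_v [W'])`. -/
def NullQuadruple.GPerpParallel (q : NullQuadruple m M) {cov : AffineConnection (m + 2) M}
    (hLam : Preserves cov q.Lam) : Prop :=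
  ∀ (U : Set M) (hU : IsOpen U) (W W' : ∀ x, q.Lam x)
    (hW : SmoothSectionOn W U) (hW' : SmoothSectionOn W' U) (x : M) (hx : x ∈ U)
    (v : TangentSpace (𝓡 (m + 2)) x),
    mvfderiv (𝓡 (m + 2)) (fun y => q.gPerp y (screenClass (W y)) (screenClass (W' y))) x v =
      q.gPerp x (screenClass (restrictConn hLam hU hW hx v)) (screenClass (W' x)) +
      q.gPerp x (screenClass (W x)) (screenClass (restrictConn hLam hU hW' hx v))

/-- `f` is covariantly constant with respect to the connection
`∇_v (X ⊗ [Y]) = ∇_v X ⊗ [Y] + X ⊗ [∇_v Y]` induced on `λ ⊗ TM/Λ` (where `∇_v [Y] = [∇_v Y]` is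
the connection that `∇` induces on `TM/Λ` when it preserves `Λ`). -/
def NullQuadruple.FParallel (q : NullQuadruple m M) {cov : AffineConnection (m + 2) M}
    (hlam : Preserves cov q.lam) : Prop :=
  ∀ (U : Set M) (hU : IsOpen U) (X : ∀ x, q.lam x) (Y : ∀ x : M, TangentSpace (𝓡 (m + 2)) x)
    (hX : SmoothSectionOn X U) (_ : SmoothFieldOn Y U) (x : M) (hx : x ∈ U)
    (v : TangentSpace (𝓡 (m + 2)) x),
    mvfderiv (𝓡 (m + 2)) (fun y => q.f y (X y ⊗ₜ[ℝ] (q.Lam y).mkQ (Y y))) x v =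
      q.f x (restrictConn hlam hU hX hx v ⊗ₜ[ℝ] (q.Lam x).mkQ (Y x) +
        X x ⊗ₜ[ℝ] (q.Lam x).mkQ (cov Y x v))

end Null

end KundtGN

end

open KundtGN

/-! Everything is read off in frames. In a frame `u` of `P`, `Λ` is the image of `k^⊥` (second
coordinate zero), `λ` is the image of `ℝ k`, and both `f` and `g^⊥` become the Minkowski product
`eta`. A metric `g` belonging to `P` therefore satisfies `g^⊥([v], [w]) = g(v, w)` on `Λ` and `f(v ⊗
[w]) = g(v, w)` for `v` in `λ` (`gPerp_eq_metric`, `f_eq_metric`).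

A tensor is of type III exactly when it vanishes on `Λ × Λ`, on `λ × TM` and on `TM × λ`
(`isTypeIII_iff`). On `Λ × Λ` the tensor `∇g` computes the derivative of `g^⊥`, on `λ × TM` that of
`f`, and `TM × λ` follows by symmetry of `g`. This gives the equivalence of 2 and 3.

For 1 and 2, differentiating the group conditions, and conversely integrating linear ODEs along `exp
(t A)`, shows that the Lie algebra of `GN` is given by the linearized conditions
(`mem_lieAlg_GN_iff`). If `g(s c, s d)` is constant for a frame field `s` with connection form `A`,
then `∇g(s c, s d) = -(eta(A c, d) + eta(c, A d))` whenever `g` is `eta` on the pairs involved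
(`covDerivTensor_frame`). So the metric conditions on `A` are the type III conditions on `∇g`, and
`A k ∈ ℝ k` corresponds to preservation of `λ`. -/

namespace KundtGN

/-! ### The Lie algebra of `GN` -/

section Algebra

variable {m : ℕ}

theorem eta_kVec_left (w : Vec (m + 2)) : eta (kVec m) w = w 1 := by
  simp [eta, kVec, stdVec, Fin.ext_iff]

theorem eta_comm (v w : Vec (m + 2)) : eta v w = eta w v := by
  simp only [eta, mul_comm]
  ring

/-- The infinitesimal version of `IsGN`. -/
def IsInfinitesimalGN (A : Vec (m + 2) →L[ℝ] Vec (m + 2)) : Prop :=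
  (∃ c : ℝ, A (kVec m) = c • kVec m) ∧
  (∀ w w' : Vec (m + 2), eta (kVec m) w = 0 → eta (kVec m) w' = 0 →
    eta (A w) w' + eta w (A w') = 0) ∧
  (∀ z : Vec (m + 2), eta (A (kVec m)) z + eta (kVec m) (A z) = 0)

/-- Pairing with `k` reads off coordinate 1, so the third condition scales that coordinate by `-c`.
In particular `A` preserves `k^⊥`. -/
theorem IsInfinitesimalGN.apply_one {A : Vec (m + 2) →L[ℝ] Vec (m + 2)}
    (hA : IsInfinitesimalGN A) {c : ℝ} (hc : A (kVec m) = c • kVec m) (z : Vec (m + 2)) :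
    A z 1 = -c * z 1 := by
  have := hA.2.2 z
  rw [hc, eta_smul_left, eta_kVec_left, eta_kVec_left] at this
  linarith

theorem hasDerivAt_exp_smul_apply (A : Vec (m + 2) →L[ℝ] Vec (m + 2)) (v : Vec (m + 2)) (t : ℝ) :
    HasDerivAt (fun t : ℝ => NormedSpace.exp (t • A) v) (A (NormedSpace.exp (t • A) v)) t :=
  (hasDerivAt_exp_smul_const' A t).clm_apply (hasDerivAt_const t v) |>.congr_deriv (by simp)

theorem exp_smul_apply_comm (A : Vec (m + 2) →L[ℝ] Vec (m + 2)) (v : Vec (m + 2)) (t : ℝ) :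
    A (NormedSpace.exp (t • A) v) = NormedSpace.exp (t • A) (A v) := by
  have h : Commute A (NormedSpace.exp (t • A)) := ((Commute.refl A).smul_right t).exp_right
  exact DFunLike.congr_fun h.eq v

theorem HasDerivAt.eta {v w : ℝ → Vec (m + 2)} {v' w' : Vec (m + 2)} {t : ℝ}
    (hv : HasDerivAt v v' t) (hw : HasDerivAt w w' t) :
    HasDerivAt (fun t => eta (v t) (w t)) (eta v' (w t) + eta (v t) w') t := by
  have hv := hasDerivAt_pi.1 hv
  have hw := hasDerivAt_pi.1 hw
  have h := (((hv 0).mul (hw 1)).add ((hv 1).mul (hw 0))).add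
    (HasDerivAt.fun_sum (u := Finset.univ)
      fun (i : Fin m) _ => (hv i.succ.succ).mul (hw i.succ.succ))
  refine h.congr_deriv ?_
  simp only [KundtGN.eta, Finset.sum_add_distrib]
  ring

theorem hasDerivAt_eta_exp (A : Vec (m + 2) →L[ℝ] Vec (m + 2)) (v w : Vec (m + 2)) (t : ℝ) :
    HasDerivAt (fun t : ℝ => eta (NormedSpace.exp (t • A) v) (NormedSpace.exp (t • A) w))
      (eta (A (NormedSpace.exp (t • A) v)) (NormedSpace.exp (t • A) w) +
        eta (NormedSpace.exp (t • A) v) (A (NormedSpace.exp (t • A) w))) t :=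
  (hasDerivAt_exp_smul_apply A v t).eta (hasDerivAt_exp_smul_apply A w t)

theorem eta_apply_add_eta_apply_eq_zero {A : Vec (m + 2) →L[ℝ] Vec (m + 2)} {v w : Vec (m + 2)}
    (h : ∀ t : ℝ, eta (NormedSpace.exp (t • A) v) (NormedSpace.exp (t • A) w) = eta v w) :
    eta (A v) w + eta v (A w) = 0 := by
  have h0 := hasDerivAt_eta_exp A v w 0
  simp only [h, zero_smul, NormedSpace.exp_zero, one_apply_eq_self] at h0
  exact h0.unique (hasDerivAt_const _ _)

/-- A function satisfying `y' = a y` is a multiple of the exponential function. -/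
theorem eq_exp_mul_of_hasDerivAt {y : ℝ → ℝ} {a : ℝ} (h : ∀ t, HasDerivAt y (a * y t) t) (t : ℝ) :
    y t = Real.exp (t * a) * y 0 := by
  have hd : ∀ s, HasDerivAt (fun s => Real.exp (-(s * a)) * y s) 0 s := fun s =>
    ((((hasDerivAt_id s).mul_const a).neg.exp).mul (h s)).congr_deriv (by simp; ring)
  have := is_const_of_deriv_eq_zero (fun s => (hd s).differentiableAt) (fun s => (hd s).deriv) t 0
  simp only [zero_mul, neg_zero, Real.exp_zero, one_mul] at this
  rw [← this, ← mul_assoc, ← Real.exp_add]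
  simp

/-- Since `A` commutes with `exp (s A)`, each coordinate of `exp (s A) k` solves `y' = c y`. -/
theorem IsInfinitesimalGN.exp_kVec {A : Vec (m + 2) →L[ℝ] Vec (m + 2)} {c : ℝ}
    (hc : A (kVec m) = c • kVec m) (t : ℝ) :
    NormedSpace.exp (t • A) (kVec m) = Real.exp (t * c) • kVec m := by
  funext i
  have hd (s : ℝ) : HasDerivAt (fun s : ℝ => NormedSpace.exp (s • A) (kVec m) i)
      (c * NormedSpace.exp (s • A) (kVec m) i) s := by
    refine (hasDerivAt_pi.1 (hasDerivAt_exp_smul_apply A (kVec m) s) i).congr_deriv ?_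
    rw [exp_smul_apply_comm, hc, map_smul]
    rfl
  simpa using eq_exp_mul_of_hasDerivAt hd t

theorem IsInfinitesimalGN.exp_apply_one {A : Vec (m + 2) →L[ℝ] Vec (m + 2)}
    (hA : IsInfinitesimalGN A) {c : ℝ} (hc : A (kVec m) = c • kVec m) (z : Vec (m + 2)) (t : ℝ) :
    NormedSpace.exp (t • A) z 1 = Real.exp (t * -c) * z 1 := by
  have hd (s : ℝ) : HasDerivAt (fun s : ℝ => NormedSpace.exp (s • A) z 1)
      (-c * NormedSpace.exp (s • A) z 1) s :=
    (hasDerivAt_pi.1 (hasDerivAt_exp_smul_apply A z s) 1).congr_deriv (hA.apply_one hc _)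
  simpa using eq_exp_mul_of_hasDerivAt hd t

/-- Both curves stay in `k^⊥`, because their coordinate 1 is only rescaled. The infinitesimal
condition then applies at every time, and the product has zero derivative. -/
theorem IsInfinitesimalGN.eta_exp {A : Vec (m + 2) →L[ℝ] Vec (m + 2)}
    (hA : IsInfinitesimalGN A) {w w' : Vec (m + 2)} (hw : eta (kVec m) w = 0)
    (hw' : eta (kVec m) w' = 0) (t : ℝ) :
    eta (NormedSpace.exp (t • A) w) (NormedSpace.exp (t • A) w') = eta w w' := by
  obtain ⟨c, hc⟩ := hA.1
  have hperp {z : Vec (m + 2)} (hz : eta (kVec m) z = 0) (s : ℝ) :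
      eta (kVec m) (NormedSpace.exp (s • A) z) = 0 := by
    rw [eta_kVec_left] at hz ⊢
    rw [hA.exp_apply_one hc, hz, mul_zero]
  have hd (s : ℝ) := (hasDerivAt_eta_exp A w w' s).congr_deriv
    (hA.2.1 _ _ (hperp hw s) (hperp hw' s))
  simpa using is_const_of_deriv_eq_zero (fun s => (hd s).differentiableAt)
    (fun s => (hd s).deriv) t 0

theorem exists_equiv_eq_exp {n : ℕ} (B : Vec n →L[ℝ] Vec n) :
    ∃ a : Vec n ≃L[ℝ] Vec n, (a : Vec n →L[ℝ] Vec n) = NormedSpace.exp B := by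
  let _ : NormedAlgebra ℚ (Vec n →L[ℝ] Vec n) := NormedAlgebra.restrictScalars ℚ ℝ _
  obtain ⟨u, hu⟩ := NormedSpace.isUnit_exp B
  exact ⟨ContinuousLinearEquiv.unitsEquiv ℝ _ u, by rw [← hu]; rfl⟩

theorem mem_lieAlg_GN_iff {A : Vec (m + 2) →L[ℝ] Vec (m + 2)} :
    A ∈ lieAlg (GN m) ↔ IsInfinitesimalGN A := by
  constructor
  · intro h
    have hE (t : ℝ) : ∃ a : Vec (m + 2) ≃L[ℝ] Vec (m + 2), IsGN a ∧
        ∀ v, a v = NormedSpace.exp (t • A) v := by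
      obtain ⟨a, ha, e⟩ := h t
      exact ⟨a, ha, fun v => DFunLike.congr_fun e v⟩
    refine ⟨⟨A (kVec m) 0, ?_⟩, fun w w' hw hw' => eta_apply_add_eta_apply_eq_zero fun t => ?_,
      fun z => eta_apply_add_eta_apply_eq_zero fun t => ?_⟩
    · funext i
      by_cases hi : i = 0
      · subst hi
        simp [kVec, stdVec]
      -- The curve `exp (t A) k` stays in `ℝ k`, so its other coordinates vanish identically, and so
      -- do their derivatives at `0`.
      · have hd := hasDerivAt_pi.1 (hasDerivAt_exp_smul_apply A (kVec m) 0) i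
        have hz : ∀ t : ℝ, NormedSpace.exp (t • A) (kVec m) i = 0 := fun t => by
          obtain ⟨a, ⟨⟨c, hc⟩, -⟩, e⟩ := hE t
          rw [← e, hc]
          simp [kVec, stdVec, hi]
        simp only [hz, zero_smul, NormedSpace.exp_zero, one_apply_eq_self] at hd
        rw [hd.unique (hasDerivAt_const _ _)]
        simp [kVec, stdVec, hi]
    · obtain ⟨a, ha, e⟩ := hE t
      rw [← e, ← e, ha.2.1 w w' hw hw']
    · obtain ⟨a, ha, e⟩ := hE t
      rw [← e, ← e, ha.2.2]
  · intro hA t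
    obtain ⟨a, ha⟩ := exists_equiv_eq_exp (t • A)
    have e (v : Vec (m + 2)) : a v = NormedSpace.exp (t • A) v := DFunLike.congr_fun ha v
    obtain ⟨c, hc⟩ := hA.1
    refine ⟨a, ⟨⟨_, (e _).trans (IsInfinitesimalGN.exp_kVec hc t)⟩,
      fun w w' hw hw' => ?_, fun z => ?_⟩, ha⟩
    · rw [e, e, hA.eta_exp hw hw']
    -- The factors `exp (t c)` from `k` and `exp (-t c)` from coordinate 1 of `z` cancel.
    · rw [e, e, IsInfinitesimalGN.exp_kVec hc, eta_smul_left, eta_kVec_left, eta_kVec_left,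
        hA.exp_apply_one hc, ← mul_assoc, ← Real.exp_add]
      simp

end Algebra

/-! ### Smooth fields and connection forms -/

section Fields

variable {n : ℕ} {M : Type*} [TopologicalSpace M] [ChartedSpace (EuclideanSpace ℝ (Fin n)) M]
  [IsManifold (𝓡 n) ∞ M]

theorem SmoothFieldOn.diffFieldAt {X : ∀ x : M, TangentSpace (𝓡 n) x} {U : Set M}
    (hX : SmoothFieldOn X U) (hU : IsOpen U) {x : M} (hx : x ∈ U) : DiffFieldAt X x :=
  (ContMDiffOn.contMDiffAt hX (hU.mem_nhds hx)).mdifferentiableAt (by simp)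

theorem SmoothFieldOn.congr {X Y : ∀ x : M, TangentSpace (𝓡 n) x} {U : Set M}
    (hX : SmoothFieldOn X U) (h : ∀ y ∈ U, Y y = X y) : SmoothFieldOn Y U :=
  ContMDiffOn.congr hX fun y hy => by rw [h y hy]

theorem cov_congr (cov : AffineConnection n M) {X Y : ∀ x : M, TangentSpace (𝓡 n) x} {U : Set M}
    (hX : SmoothFieldOn X U) (hU : IsOpen U) (h : ∀ y ∈ U, Y y = X y) {x : M} (hx : x ∈ U) :
    cov Y x = cov X x :=
  cov.isCovariantDerivativeOn.congr_of_eqOn ((hX.congr h).diffFieldAt hU hx)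
    (hX.diffFieldAt hU hx) (hU.mem_nhds hx) h

theorem stdVec_sum (c : Vec n) : ∑ j, c j • stdVec n j = c :=
  (pi_eq_sum_univ' c).symm

theorem SmoothFrameOn.smoothFieldOn {s : ∀ x : M, Frame n x} {U : Set M} (hs : SmoothFrameOn s U)
    (c : Vec n) : SmoothFieldOn (fun x => s x c) U := by
  have h : SmoothFieldOn (fun x => ∑ j, c j • s x (stdVec n j)) U :=
    ContMDiffOn.sum_section fun j _ => (hs j).const_smul_section
  refine h.congr fun y _ => ?_
  conv_lhs => rw [← stdVec_sum c]
  simp only [map_sum, map_smul]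

/-- Both sides are linear in the constant vector `c` and agree on the standard basis by the
definition of the connection form. -/
theorem cov_frame (cov : AffineConnection n M) {s : ∀ x : M, Frame n x} {U : Set M}
    (hs : SmoothFrameOn s U) (hU : IsOpen U) {x : M} (hx : x ∈ U) (v : TangentSpace (𝓡 n) x)
    (c : Vec n) : cov (fun y => s y c) x v = s x (connectionForm cov s x v c) := by
  have hd (c : Vec n) : DiffFieldAt (fun y => s y c) x := (hs.smoothFieldOn c).diffFieldAt hU hx
  let L : Vec n →ₗ[ℝ] TangentSpace (𝓡 n) x :=
    { toFun c := cov (fun y => s y c) x v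
      map_add' c d := by
        have e : (fun y => s y (c + d)) = (fun y => s y c) + fun y => s y d :=
          funext fun y => map_add _ _ _
        rw [e, cov.isCovariantDerivativeOn.add (hd c) (hd d)]
        rfl
      map_smul' r c := by
        have e : (fun y => s y (r • c)) = r • fun y => s y c :=
          funext fun y => map_smul _ _ _
        rw [e, cov.isCovariantDerivativeOn.smul_const r (hd c)]
        rfl }
  have hL : L = (s x).toLinearMap ∘ₗ (connectionForm cov s x v).toLinearMap := by
    refine (Pi.basisFun ℝ (Fin n)).ext fun j => ?_
    have : connectionForm cov s x v (Pi.basisFun ℝ (Fin n) j) =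
        (s x).symm (cov (fun y => s y (stdVec n j)) x v) :=
      (Pi.basisFun ℝ (Fin n)).constr_basis ℝ _ j
    change _ = s x (connectionForm cov s x v (Pi.basisFun ℝ (Fin n) j))
    rw [this, ContinuousLinearEquiv.apply_symm_apply, Pi.basisFun_apply]
    rfl
  exact DFunLike.congr_fun hL c

/-- Extension by zero outside `U`; sections of `D` are total functions, but smoothness is only asked
on `U`. -/
theorem exists_section_eqOn {D : ∀ x : M, Submodule ℝ (TangentSpace (𝓡 n) x)} {U : Set M}
    {X : ∀ x : M, TangentSpace (𝓡 n) x} (hX : SmoothFieldOn X U) (h : ∀ y ∈ U, X y ∈ D y) :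
    ∃ W : ∀ x, D x, SmoothSectionOn W U ∧ ∀ y ∈ U, (W y : TangentSpace (𝓡 n) y) = X y := by
  classical
  refine ⟨fun y => if hy : y ∈ U then ⟨X y, h y hy⟩ else 0, hX.congr fun y hy => ?_,
    fun y hy => ?_⟩ <;> simp [hy]

end Fields

/-! ### Null-quadruples and type III tensors in an adapted frame -/

section NullFrames

variable {m : ℕ} {M : Type*} [TopologicalSpace M]
  [ChartedSpace (EuclideanSpace ℝ (Fin (m + 2))) M] [IsManifold (𝓡 (m + 2)) ∞ M]

theorem apply_eq_sum {M : Type*} [TopologicalSpace M]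
    [ChartedSpace (EuclideanSpace ℝ (Fin (m + 2))) M] {x : M} (u : Frame (m + 2) x) (c : Vec (m + 2)) :
    u c = c 0 • u (stdVec (m + 2) 0) + (c 1 • u (stdVec (m + 2) 1) +
      ∑ i : Fin m, c i.succ.succ • u (stdVec (m + 2) i.succ.succ)) := by
  conv_lhs => rw [← stdVec_sum c]
  simp only [map_sum, map_smul]
  rw [Fin.sum_univ_succ, Fin.sum_univ_succ]
  rfl

variable {q : NullQuadruple m M} {x : M} {u : Frame (m + 2) x}

/-- All frame vectors except `Y` lie in `Λ`, while `Y` does not, since `f(X ⊗ [Y]) = 1` forces `[Y]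
≠ 0`. -/
theorem NullQuadruple.apply_mem_Lam_iff (hu : u ∈ q.frames x) (c : Vec (m + 2)) :
    u c ∈ q.Lam x ↔ c 1 = 0 := by
  obtain ⟨hX, hZ, hf, -⟩ := hu
  have hY : u (stdVec (m + 2) 1) ∉ q.Lam x := fun h => by
    rw [Submodule.mkQ_apply, (Submodule.Quotient.mk_eq_zero _).2 h] at hf
    simp at hf
  have hsum : ∑ i : Fin m, c i.succ.succ • u (stdVec (m + 2) i.succ.succ) ∈ q.Lam x :=
    Submodule.sum_mem _ fun i _ => Submodule.smul_mem _ _ (hZ i)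
  rw [apply_eq_sum u c, Submodule.add_mem_iff_right _
    (Submodule.smul_mem _ _ (q.lam_le x hX)), Submodule.add_mem_iff_left _ hsum]
  by_cases h : c 1 = 0
  · simp [h]
  · simp [h, Submodule.smul_mem_iff, hY]

theorem NullQuadruple.apply_mem_lam_iff (hu : u ∈ q.frames x) (c : Vec (m + 2)) :
    u c ∈ q.lam x ↔ ∃ r : ℝ, c = r • kVec m := by
  obtain ⟨hX, -⟩ := hu
  constructor
  · intro hc
    obtain ⟨U, -, hxU, X, -, hspan⟩ := q.smooth_lam x
    obtain ⟨hli, hspan⟩ := hspan x hxU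
    have hfin : Module.finrank ℝ (q.lam x) = 1 := by
      rw [← hspan, finrank_span_eq_card hli, Fintype.card_fin]
    have h0 : (⟨u (kVec m), hX⟩ : q.lam x) ≠ 0 := fun h =>
      kVec_ne_zero m (u.injective ((congrArg Subtype.val h).trans (map_zero u).symm))
    obtain ⟨r, hr⟩ := (finrank_eq_one_iff_of_nonzero' _ h0).1 hfin ⟨u c, hc⟩
    exact ⟨r, u.injective (by rw [map_smul]; exact (congrArg Subtype.val hr).symm)⟩
  · rintro ⟨r, rfl⟩
    rw [map_smul]
    exact Submodule.smul_mem _ _ hX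

theorem NullQuadruple.f_apply (hu : u ∈ q.frames x) {c : Vec (m + 2)} (hc : u c ∈ q.lam x)
    (d : Vec (m + 2)) : q.f x (⟨u c, hc⟩ ⊗ₜ[ℝ] (q.Lam x).mkQ (u d)) = eta c d := by
  obtain ⟨r, rfl⟩ := (apply_mem_lam_iff hu c).1 hc
  have hd : (q.Lam x).mkQ (u d) = d 1 • (q.Lam x).mkQ (u (stdVec (m + 2) 1)) := by
    rw [← map_smul, ← map_smul, Submodule.mkQ_apply, Submodule.mkQ_apply, Submodule.Quotient.eq,
      ← map_sub, apply_mem_Lam_iff hu]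
    simp [stdVec]
  obtain ⟨hX, -, hf, -⟩ := hu
  have hk : (⟨u (r • kVec m), hc⟩ : q.lam x) = r • ⟨u (stdVec (m + 2) 0), hX⟩ :=
    Subtype.ext (map_smul u r _)
  rw [hd, hk, TensorProduct.smul_tmul_smul, map_smul, hf, eta_smul_left, eta_kVec_left]
  simp

/-- Modulo `λ` only the `Z_i` components survive, and their classes are orthonormal; on `k^⊥` the
product `eta` likewise ignores the `k` component. -/
theorem NullQuadruple.gPerp_apply (hu : u ∈ q.frames x) {c d : Vec (m + 2)}
    (hc : u c ∈ q.Lam x) (hd : u d ∈ q.Lam x) :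
    q.gPerp x (screenClass ⟨u c, hc⟩) (screenClass ⟨u d, hd⟩) = eta c d := by
  have hc1 := (apply_mem_Lam_iff hu c).1 hc
  have hd1 := (apply_mem_Lam_iff hu d).1 hd
  obtain ⟨hX, hZ, -, hg⟩ := hu
  have key (c : Vec (m + 2)) (hc : u c ∈ q.Lam x) (hc1 : c 1 = 0) :
      (screenClass ⟨u c, hc⟩ : ScreenSpace q.lam q.Lam x) =
        ∑ i : Fin m, c i.succ.succ • screenClass ⟨u (stdVec (m + 2) i.succ.succ), hZ i⟩ := by
    have : (⟨u c, hc⟩ : q.Lam x) = c 0 • ⟨u (stdVec (m + 2) 0), q.lam_le x hX⟩ +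
        ∑ i : Fin m, c i.succ.succ • ⟨u (stdVec (m + 2) i.succ.succ), hZ i⟩ := by
      apply Subtype.ext
      simp only [Submodule.coe_add, Submodule.coe_smul, Submodule.coe_sum]
      rw [apply_eq_sum u c, hc1, zero_smul, zero_add]
    have h0 : (screenClass ⟨u (stdVec (m + 2) 0), q.lam_le x hX⟩ :
        ScreenSpace q.lam q.Lam x) = 0 := (Submodule.Quotient.mk_eq_zero _).2 hX
    simp only [screenClass] at h0 ⊢
    rw [this, Submodule.Quotient.mk_add, Submodule.Quotient.mk_smul, h0, smul_zero, zero_add,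
      ← Submodule.mkQ_apply, map_sum]
    rfl
  rw [key c hc hc1, key d hd hd1]
  simp only [map_sum, map_smul, LinearMap.sum_apply, LinearMap.smul_apply, hg]
  simp [eta, hc1, hd1, mul_comm]

/-- With `α` the coordinate along `Y`, every `v` differs from `α(v) Y` by an element of `Λ`.
Vanishing on `Λ × Λ` thus lets `T` be rebuilt from its values with one argument equal to `Y`. -/
theorem NullQuadruple.isTypeIII_iff (hu : u ∈ q.frames x)
    (T : TangentSpace (𝓡 (m + 2)) x →L[ℝ] TangentSpace (𝓡 (m + 2)) x →L[ℝ] ℝ) :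
    q.IsTypeIII T ↔ (∀ v ∈ q.Lam x, ∀ w ∈ q.Lam x, T v w = 0) ∧
      ∀ v ∈ q.lam x, ∀ w, T v w = 0 ∧ T w v = 0 := by
  constructor
  · rintro ⟨B, hB, hTB⟩
    simp only [hTB]
    clear hTB
    induction hB using Submodule.span_induction with
    | mem B hB =>
      obtain ⟨s₁, s₂, hs, α, hα, β, hβ, rfl⟩ := hB
      -- Degrees in `{-1, 0, 1}` with sum `-1` leave only these two cases.
      have : (s₁ = -1 ∧ s₂ = 0) ∨ (s₁ = 0 ∧ s₂ = -1) := by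
        revert hs
        cases s₁ <;> cases s₂ <;> simp
      rcases this with ⟨rfl, rfl⟩ | ⟨rfl, rfl⟩
      · have hα := (Submodule.mem_dualAnnihilator α).1 hα
        have hβ := (Submodule.mem_dualAnnihilator β).1 hβ
        refine ⟨fun v hv w hw => ?_, fun v hv w => ?_⟩
        · simp [LinearMap.BilinForm.linMulLin, hα v hv]
        · simp [LinearMap.BilinForm.linMulLin, hα v (q.lam_le x hv), hβ v hv]
      · have hα := (Submodule.mem_dualAnnihilator α).1 hα
        have hβ := (Submodule.mem_dualAnnihilator β).1 hβ
        refine ⟨fun v hv w hw => ?_, fun v hv w => ?_⟩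
        · simp [LinearMap.BilinForm.linMulLin, hβ w hw]
        · simp [LinearMap.BilinForm.linMulLin, hβ v (q.lam_le x hv), hα v hv]
    | zero => simp
    | add B B' _ _ h h' =>
      exact ⟨fun v hv w hw => by simp [h.1 v hv w hw, h'.1 v hv w hw],
        fun v hv w => by simp [h.2 v hv w, h'.2 v hv w]⟩
    | smul a B _ h =>
      exact ⟨fun v hv w hw => by simp [h.1 v hv w hw], fun v hv w => by simp [h.2 v hv w]⟩
  · rintro ⟨hLL, hlT⟩
    let Y := u (stdVec (m + 2) 1)
    let α : Module.Dual ℝ (TangentSpace (𝓡 (m + 2)) x) :=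
      LinearMap.proj (1 : Fin (m + 2)) ∘ₗ u.symm.toLinearMap
    let β : Module.Dual ℝ (TangentSpace (𝓡 (m + 2)) x) := (T Y).toLinearMap
    -- The correction `T(Y, Y) α` keeps the `Y, Y` component from being counted twice in `T = α ⊗ β
    -- + γ ⊗ α`.
    let γ : Module.Dual ℝ (TangentSpace (𝓡 (m + 2)) x) :=
      { toFun v := T v Y - T Y Y * α v
        map_add' v w := by rw [map_add, map_add, _root_.add_apply]; ring
        map_smul' r v := by
          rw [map_smul, map_smul, _root_.smul_apply, smul_eq_mul, smul_eq_mul, RingHom.id_apply,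
            smul_eq_mul]
          ring }
    have hα (v) : α v = u.symm v 1 := rfl
    have hβ (v) : β v = T Y v := rfl
    have hγ (v) : γ v = T v Y - T Y Y * α v := rfl
    have hαL (v) (hv : v ∈ q.Lam x) : α v = 0 := by
      rw [hα, ← apply_mem_Lam_iff hu, u.apply_symm_apply]
      exact hv
    have hsub (v) : v - α v • Y ∈ q.Lam x := by
      have : v - α v • Y = u (u.symm v - α v • stdVec (m + 2) 1) := by
        rw [map_sub, map_smul, u.apply_symm_apply]
      rw [this, apply_mem_Lam_iff hu]
      simp [hα, stdVec]
    refine ⟨LinearMap.BilinForm.linMulLin α β + LinearMap.BilinForm.linMulLin γ α,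
      add_mem (Submodule.subset_span ⟨.neg, .zero, rfl, α, ?_, β, ?_, rfl⟩)
        (Submodule.subset_span ⟨.zero, .neg, rfl, γ, ?_, α, ?_, rfl⟩), fun v w => ?_⟩
    · exact (Submodule.mem_dualAnnihilator α).2 hαL
    · exact (Submodule.mem_dualAnnihilator β).2 fun v hv => (hlT v hv Y).2
    · refine (Submodule.mem_dualAnnihilator γ).2 fun v hv => ?_
      rw [hγ, (hlT v hv Y).1, hαL v (q.lam_le x hv)]
      simp
    · exact (Submodule.mem_dualAnnihilator α).2 hαL
    · have := hLL _ (hsub v) _ (hsub w)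
      simp only [map_sub, map_smul, _root_.sub_apply, _root_.smul_apply, smul_eq_mul] at this
      simp only [LinearMap.add_apply, LinearMap.BilinForm.linMulLin_apply, hβ, hγ]
      linarith

end NullFrames

/-! ### Comparing `∇g` with the derivatives of `g^⊥` and `f` -/

section Main

variable {m : ℕ} {M : Type*} [TopologicalSpace M]
  [ChartedSpace (EuclideanSpace ℝ (Fin (m + 2))) M] [IsManifold (𝓡 (m + 2)) ∞ M]
  {P : GStructure (m + 2) M (GN m)} {q : NullQuadruple m M} {g : LorentzMetric m M}

theorem mvfderiv_eq_zero {n : ℕ} {M : Type*} [TopologicalSpace M]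
    [ChartedSpace (EuclideanSpace ℝ (Fin n)) M] {φ : M → ℝ} {a : ℝ} {x : M}
    (h : ∀ᶠ y in 𝓝 x, φ y = a) : mvfderiv (𝓡 n) φ x = 0 := by
  have : HasMFDerivAt (𝓡 n) 𝓘(ℝ, ℝ) φ x 0 := (hasMFDerivAt_const a x).congr_of_eventuallyEq h
  rw [mvfderiv, this.mfderiv]
  simp

theorem covDerivTensor_symm (cov : AffineConnection (m + 2) M) (g : LorentzMetric m M) {x : M}
    (v : TangentSpace (𝓡 (m + 2)) x) {Y W : ∀ x : M, TangentSpace (𝓡 (m + 2)) x}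
    (hY : DiffFieldAt Y x) (hW : DiffFieldAt W x) :
    covDerivTensor cov g.toTwoTensor v (Y x) (W x) =
      covDerivTensor cov g.toTwoTensor v (W x) (Y x) := by
  rw [covDerivTensor_apply cov _ v hY hW, covDerivTensor_apply cov _ v hW hY,
    g.symm x (cov Y x v), g.symm x (Y x), funext fun y => g.symm y (Y y) (W y)]
  ring

theorem LorentzMetric.BelongsTo.exists_section (hg : g.BelongsTo P) (x : M) :
    ∃ (U : Set M) (s : ∀ y : M, Frame (m + 2) y), IsOpen U ∧ x ∈ U ∧ P.IsSection s U ∧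
      ∀ y ∈ U, ∀ c d, g.toFun y (s y c) (s y d) = eta c d := by
  obtain ⟨Q, hQP, hQ⟩ := hg
  obtain ⟨U, hU, hx, s, hs, hsQ⟩ := Q.exists_section x
  exact ⟨U, s, hU, hx, ⟨hs, fun y hy => hQP y (hsQ y hy)⟩, fun y hy => hQ y _ (hsQ y hy)⟩

theorem LorentzMetric.BelongsTo.exists_frame (hg : g.BelongsTo P) (hPq : Corresponds P q) (x : M) :
    ∃ u ∈ q.frames x, ∀ c d, g.toFun x (u c) (u d) = eta c d := by
  obtain ⟨U, s, -, hx, hs, hgs⟩ := hg.exists_section x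
  exact ⟨s x, hPq x ▸ hs.2 x hx, hgs x hx⟩

theorem gPerp_eq_metric (hPq : Corresponds P q) (hg : g.BelongsTo P) {x : M} (v w : q.Lam x) :
    q.gPerp x (screenClass v) (screenClass w) = g.toFun x v w := by
  obtain ⟨u, hu, hgu⟩ := hg.exists_frame hPq x
  obtain ⟨v, hv⟩ := v
  obtain ⟨w, hw⟩ := w
  obtain ⟨c, rfl⟩ := u.surjective v
  obtain ⟨d, rfl⟩ := u.surjective w
  rw [NullQuadruple.gPerp_apply hu, hgu]

theorem f_eq_metric (hPq : Corresponds P q) (hg : g.BelongsTo P) {x : M} (v : q.lam x)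
    (w : TangentSpace (𝓡 (m + 2)) x) :
    q.f x (v ⊗ₜ[ℝ] (q.Lam x).mkQ w) = g.toFun x v w := by
  obtain ⟨u, hu, hgu⟩ := hg.exists_frame hPq x
  obtain ⟨v, hv⟩ := v
  obtain ⟨c, rfl⟩ := u.surjective v
  obtain ⟨d, rfl⟩ := u.surjective w
  rw [NullQuadruple.f_apply hu, hgu]

variable {cov : AffineConnection (m + 2) M}

theorem GPerpParallel_iff (hPq : Corresponds P q) (hg : g.BelongsTo P)
    (hLam : Preserves cov q.Lam) :
    q.GPerpParallel hLam ↔ ∀ (U : Set M), IsOpen U → ∀ W W' : ∀ x, q.Lam x,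
      SmoothSectionOn W U → SmoothSectionOn W' U → ∀ x ∈ U, ∀ v : TangentSpace (𝓡 (m + 2)) x,
        covDerivTensor cov g.toTwoTensor v (W x) (W' x) = 0 := by
  refine forall₄_congr fun U hU W W' => forall₅_congr fun hW hW' x hx v => ?_
  rw [covDerivTensor_apply cov _ v (hW.diffFieldAt hU hx) (hW'.diffFieldAt hU hx), sub_sub,
    sub_eq_zero]
  simp only [gPerp_eq_metric hPq hg]
  rfl

theorem FParallel_iff (hPq : Corresponds P q) (hg : g.BelongsTo P) (hlam : Preserves cov q.lam) :
    q.FParallel hlam ↔ ∀ (U : Set M), IsOpen U → ∀ (X : ∀ x, q.lam x)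
      (Y : ∀ x : M, TangentSpace (𝓡 (m + 2)) x), SmoothSectionOn X U → SmoothFieldOn Y U →
      ∀ x ∈ U, ∀ v : TangentSpace (𝓡 (m + 2)) x,
        covDerivTensor cov g.toTwoTensor v (X x) (Y x) = 0 := by
  refine forall₄_congr fun U hU X Y => forall₅_congr fun hX hY x hx v => ?_
  rw [covDerivTensor_apply cov _ v (hX.diffFieldAt hU hx) (hY.diffFieldAt hU hx), sub_sub,
    sub_eq_zero]
  simp only [map_add, f_eq_metric hPq hg]
  rfl

theorem exists_Lam_section (hPq : Corresponds P q) {s : ∀ x : M, Frame (m + 2) x} {U : Set M}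
    (hs : P.IsSection s U) {c : Vec (m + 2)} (hc : c 1 = 0) :
    ∃ W : ∀ x, q.Lam x, SmoothSectionOn W U ∧
      ∀ y ∈ U, (W y : TangentSpace (𝓡 (m + 2)) y) = s y c :=
  exists_section_eqOn (hs.1.smoothFieldOn c) fun y hy =>
    (NullQuadruple.apply_mem_Lam_iff (hPq y ▸ hs.2 y hy) c).2 hc

theorem exists_lam_section (hPq : Corresponds P q) {s : ∀ x : M, Frame (m + 2) x} {U : Set M}
    (hs : P.IsSection s U) (r : ℝ) :
    ∃ X : ∀ x, q.lam x, SmoothSectionOn X U ∧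
      ∀ y ∈ U, (X y : TangentSpace (𝓡 (m + 2)) y) = s y (r • kVec m) :=
  exists_section_eqOn (hs.1.smoothFieldOn _) fun y hy =>
    (NullQuadruple.apply_mem_lam_iff (hPq y ▸ hs.2 y hy) _).2 ⟨r, rfl⟩

theorem forall_isTypeIII_iff (hPq : Corresponds P q) (hg : g.BelongsTo P)
    (hlam : Preserves cov q.lam) (hLam : Preserves cov q.Lam) :
    (∀ (x : M) (v : TangentSpace (𝓡 (m + 2)) x),
      q.IsTypeIII (covDerivTensor cov g.toTwoTensor v)) ↔
    q.GPerpParallel hLam ∧ q.FParallel hlam := by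
  rw [GPerpParallel_iff hPq hg, FParallel_iff hPq hg]
  constructor
  · intro h
    refine ⟨fun U hU W W' _ _ x _ v => ?_, fun U hU X Y _ _ x _ v => ?_⟩ <;>
      obtain ⟨u, hu, -⟩ := hg.exists_frame hPq x <;>
      obtain ⟨h1, h2⟩ := (NullQuadruple.isTypeIII_iff hu _).1 (h x v)
    · exact h1 _ (W x).2 _ (W' x).2
    · exact (h2 _ (X x).2 _).1
  · rintro ⟨h1, h2⟩ x v
    obtain ⟨U, s, hU, hx, hs, -⟩ := hg.exists_section x
    have hu : s x ∈ q.frames x := hPq x ▸ hs.2 x hx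
    refine (NullQuadruple.isTypeIII_iff hu _).2 ⟨fun a ha b hb => ?_, fun a ha b => ?_⟩ <;>
      obtain ⟨c, rfl⟩ := (s x).surjective a <;> obtain ⟨d, rfl⟩ := (s x).surjective b
    · obtain ⟨W, hW, eW⟩ := exists_Lam_section hPq hs ((NullQuadruple.apply_mem_Lam_iff hu c).1 ha)
      obtain ⟨W', hW', eW'⟩ :=
        exists_Lam_section hPq hs ((NullQuadruple.apply_mem_Lam_iff hu d).1 hb)
      rw [← eW x hx, ← eW' x hx]
      exact h1 U hU W W' hW hW' x hx v
    · obtain ⟨r, rfl⟩ := (NullQuadruple.apply_mem_lam_iff hu c).1 ha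
      obtain ⟨X, hX, eX⟩ := exists_lam_section hPq hs r
      have hd := hs.1.smoothFieldOn d
      have h0 := h2 U hU X _ hX hd x hx v
      have h0' := h0
      -- Parallelism of `f` only gives vanishing on `λ × TM`; symmetry supplies `TM × λ`.
      rw [covDerivTensor_symm cov g v (hX.diffFieldAt hU hx) (hd.diffFieldAt hU hx)] at h0'
      rw [← eX x hx]
      exact ⟨h0, h0'⟩

/-! ### Connection forms and `∇g` -/

theorem covDerivTensor_frame {s : ∀ x : M, Frame (m + 2) x} {U : Set M} (hs : SmoothFrameOn s U)
    (hU : IsOpen U) {x : M} (hx : x ∈ U) (v : TangentSpace (𝓡 (m + 2)) x) {c d : Vec (m + 2)}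
    {a : ℝ} (hgs : ∀ y ∈ U, g.toFun y (s y c) (s y d) = a) :
    covDerivTensor cov g.toTwoTensor v (s x c) (s x d) =
      -(g.toFun x (s x (connectionForm cov s x v c)) (s x d) +
        g.toFun x (s x c) (s x (connectionForm cov s x v d))) := by
  have h := covDerivTensor_apply cov g.toTwoTensor v ((hs.smoothFieldOn c).diffFieldAt hU hx)
    ((hs.smoothFieldOn d).diffFieldAt hU hx)
  rw [h, cov_frame cov hs hU hx, cov_frame cov hs hU hx,
    mvfderiv_eq_zero (Filter.eventually_of_mem (hU.mem_nhds hx) hgs), _root_.zero_apply]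
  ring

theorem metric_apply_lam (hPq : Corresponds P q) (hg : g.BelongsTo P) {x : M}
    {u : Frame (m + 2) x} (hu : u ∈ q.frames x) (r : ℝ) (d : Vec (m + 2)) :
    g.toFun x (u (r • kVec m)) (u d) = eta (r • kVec m) d := by
  have hc := (NullQuadruple.apply_mem_lam_iff hu (r • kVec m)).2 ⟨r, rfl⟩
  rw [← NullQuadruple.f_apply hu hc, f_eq_metric hPq hg]

theorem metric_apply_Lam (hPq : Corresponds P q) (hg : g.BelongsTo P) {x : M}
    {u : Frame (m + 2) x} (hu : u ∈ q.frames x) {c d : Vec (m + 2)} (hc : c 1 = 0)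
    (hd : d 1 = 0) : g.toFun x (u c) (u d) = eta c d := by
  rw [← NullQuadruple.gPerp_apply hu ((NullQuadruple.apply_mem_Lam_iff hu c).2 hc)
    ((NullQuadruple.apply_mem_Lam_iff hu d).2 hd), gPerp_eq_metric hPq hg]

/-- An arbitrary section of `P` need not consist of null-frames for `g`, but `g(s c, s d) = eta(c,
d)` still holds when `c ∈ ℝ k` or when both `c` and `d` lie in `k^⊥`. These are the only pairs
occurring in the Lie algebra conditions. -/
theorem isConnectionIn_of_isTypeIII (hPq : Corresponds P q) (hg : g.BelongsTo P)
    (hlam : Preserves cov q.lam) (hLam : Preserves cov q.Lam)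
    (hT : ∀ (x : M) (v : TangentSpace (𝓡 (m + 2)) x),
      q.IsTypeIII (covDerivTensor cov g.toTwoTensor v)) : IsConnectionIn cov P := by
  intro U hU s hs x hx v
  rw [mem_lieAlg_GN_iff]
  have hq (y) (hy : y ∈ U) : s y ∈ q.frames y := hPq y ▸ hs.2 y hy
  have hu := hq x hx
  obtain ⟨hT1, hT2⟩ := (NullQuadruple.isTypeIII_iff hu _).1 (hT x v)
  have hk : ∃ r : ℝ, connectionForm cov s x v (kVec m) = r • kVec m := by
    obtain ⟨X, hX, eX⟩ := exists_lam_section hPq hs 1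
    have h := hlam U hU X hX x hx v
    rwa [cov_congr cov (hs.1.smoothFieldOn _) hU eX hx, cov_frame cov hs.1 hU hx,
      NullQuadruple.apply_mem_lam_iff hu, one_smul] at h
  have hL {c : Vec (m + 2)} (hc : c 1 = 0) : connectionForm cov s x v c 1 = 0 := by
    obtain ⟨W, hW, eW⟩ := exists_Lam_section hPq hs hc
    have h := hLam U hU W hW x hx v
    rwa [cov_congr cov (hs.1.smoothFieldOn _) hU eW hx, cov_frame cov hs.1 hU hx,
      NullQuadruple.apply_mem_Lam_iff hu] at h
  have hlamη (y) (hy : y ∈ U) (d : Vec (m + 2)) :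
      g.toFun y (s y (kVec m)) (s y d) = eta (kVec m) d := by
    simpa using metric_apply_lam hPq hg (hq y hy) 1 d
  refine ⟨hk, fun w w' hw hw' => ?_, fun z => ?_⟩
  · rw [eta_kVec_left] at hw hw'
    have h := covDerivTensor_frame (cov := cov) hs.1 hU hx v
      fun y hy => metric_apply_Lam hPq hg (hq y hy) hw hw'
    rw [hT1 _ ((NullQuadruple.apply_mem_Lam_iff hu w).2 hw) _
        ((NullQuadruple.apply_mem_Lam_iff hu w').2 hw'),
      metric_apply_Lam hPq hg hu (hL hw) hw', metric_apply_Lam hPq hg hu hw (hL hw')] at h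
    linarith
  · have h := covDerivTensor_frame (cov := cov) hs.1 hU hx v fun y hy => hlamη y hy z
    rw [(hT2 _ ((NullQuadruple.apply_mem_lam_iff hu _).2 ⟨1, (one_smul ℝ _).symm⟩) _).1,
      hlamη x hx] at h
    obtain ⟨r, hr⟩ := hk
    rw [hr, metric_apply_lam hPq hg hu, ← hr] at h
    linarith

/-- This is `(k^⊥)^⊥ = ℝ k`: testing against `k` kills coordinate 1, and testing against the `m_j`
kills the remaining ones. -/
theorem eq_smul_kVec_of_eta_eq_zero {e : Vec (m + 2)} (h : ∀ d, d 1 = 0 → eta e d = 0) :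
    e = e 0 • kVec m := by
  funext i
  have h1 : e 1 = 0 := by
    have := h (kVec m) (by simp [kVec, stdVec])
    rwa [eta_comm, eta_kVec_left] at this
  have h2 (j : Fin m) : e j.succ.succ = 0 := by
    have h10 : (1 : Fin (m + 2)) ≠ j.succ.succ := by simp [Fin.ext_iff]
    have h00 : (0 : Fin (m + 2)) ≠ j.succ.succ := by simp [Fin.ext_iff]
    have := h (stdVec (m + 2) j.succ.succ) (by simp [stdVec, h10])
    simpa [eta, stdVec, h10, h00, Pi.single_apply, h1] using this
  refine Fin.cases ?_ (fun i => Fin.cases ?_ (fun j => ?_) i) i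
  · simp [kVec, stdVec]
  · exact h1.trans (by simp [kVec, stdVec])
  · exact (h2 j).trans (by simp [kVec, stdVec])

/-- If `W` is `g`-orthogonal to the field `s d` of a null-frame, then `∇_v W` and `s (A(v) c)`,
where `W x = s x c`, have the same `g`-product with `s d`. -/
theorem eta_cov_eq {s : ∀ x : M, Frame (m + 2) x} {U : Set M} (hs : SmoothFrameOn s U)
    (hU : IsOpen U) (hgs : ∀ y ∈ U, ∀ c d, g.toFun y (s y c) (s y d) = eta c d) {x : M}
    (hx : x ∈ U) (v : TangentSpace (𝓡 (m + 2)) x) {W : ∀ x : M, TangentSpace (𝓡 (m + 2)) x}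
    (hW : DiffFieldAt W x) {c d e : Vec (m + 2)} (hc : W x = s x c)
    (he : cov W x v = s x e) (hWd : ∀ᶠ y in 𝓝 x, g.toFun y (W y) (s y d) = 0) :
    eta e d = eta (connectionForm cov s x v c) d := by
  have h := covDerivTensor_apply cov g.toTwoTensor v hW ((hs.smoothFieldOn d).diffFieldAt hU hx)
  -- By tensoriality `∇_v g` sees only `W x = s x c`, so it may be computed with `W` or with the
  -- field `s c`. The terms containing `∇_v (s d)` cancel in the comparison.
  rw [mvfderiv_eq_zero hWd, hc, he, covDerivTensor_frame hs hU hx v fun y hy => hgs y hy c d,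
    cov_frame cov hs hU hx, hgs x hx, hgs x hx, hgs x hx, _root_.zero_apply] at h
  linarith

/-- Here one null-frame section per point, taken from `Q`, suffices. Preservation must hold for all
sections of `λ` and `Λ`; writing these as `g`-orthogonal complements of each other and
differentiating `g(W, s d) = 0` avoids smooth coefficient functions of `W`. -/
theorem preserves_and_isTypeIII_of_isConnectionIn (hPq : Corresponds P q) (hg : g.BelongsTo P)
    (h : IsConnectionIn cov P) :
    Preserves cov q.lam ∧ Preserves cov q.Lam ∧
      ∀ (x : M) (v : TangentSpace (𝓡 (m + 2)) x),
        q.IsTypeIII (covDerivTensor cov g.toTwoTensor v) := by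
  refine ⟨fun U' hU' W hW x hx' v => ?_, fun U' hU' W hW x hx' v => ?_, fun x v => ?_⟩ <;>
    obtain ⟨U, s, hU, hx, hs, hgs⟩ := hg.exists_section x <;>
    have hq (y) (hy : y ∈ U) : s y ∈ q.frames y := hPq y ▸ hs.2 y hy <;>
    have hu := hq x hx <;>
    have hA := mem_lieAlg_GN_iff.1 (h U hU s hs x hx v) <;>
    obtain ⟨a, ha⟩ := hA.1
  · obtain ⟨e, he⟩ := (s x).surjective (cov (fun y => (W y : TangentSpace (𝓡 (m + 2)) y)) x v)
    obtain ⟨c, hc⟩ := (s x).surjective (W x)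
    obtain ⟨r, rfl⟩ := (NullQuadruple.apply_mem_lam_iff hu c).1 (hc ▸ (W x).2)
    rw [← he, NullQuadruple.apply_mem_lam_iff hu]
    refine ⟨_, eq_smul_kVec_of_eta_eq_zero fun d hd => ?_⟩
    rw [eta_cov_eq hs.1 hU hgs hx v (hW.diffFieldAt hU' hx') hc.symm he.symm, map_smul, ha,
      eta_smul_left, eta_smul_left, eta_kVec_left, hd, mul_zero, mul_zero]
    filter_upwards [hU.mem_nhds hx] with y hy
    obtain ⟨b, hb⟩ := (s y).surjective (W y)
    obtain ⟨t, rfl⟩ := (NullQuadruple.apply_mem_lam_iff (hq y hy) b).1 (hb ▸ (W y).2)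
    rw [← hb, hgs y hy, eta_smul_left, eta_kVec_left, hd, mul_zero]
  · obtain ⟨e, he⟩ := (s x).surjective (cov (fun y => (W y : TangentSpace (𝓡 (m + 2)) y)) x v)
    obtain ⟨c, hc⟩ := (s x).surjective (W x)
    have hc1 := (NullQuadruple.apply_mem_Lam_iff hu c).1 (hc ▸ (W x).2)
    -- Since `Λ = λ^⊥`, the single test vector `d = k` is enough.
    rw [← he, NullQuadruple.apply_mem_Lam_iff hu, ← eta_kVec_left e, eta_comm,
      eta_cov_eq hs.1 hU hgs hx v (hW.diffFieldAt hU' hx') hc.symm he.symm, eta_comm,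
      eta_kVec_left, hA.apply_one ha, hc1, mul_zero]
    filter_upwards [hU.mem_nhds hx] with y hy
    obtain ⟨b, hb⟩ := (s y).surjective (W y)
    rw [← hb, hgs y hy, eta_comm, eta_kVec_left]
    exact (NullQuadruple.apply_mem_Lam_iff (hq y hy) b).1 (hb ▸ (W y).2)
  · have hT (c d : Vec (m + 2)) : covDerivTensor cov g.toTwoTensor v (s x c) (s x d) =
        -(eta (connectionForm cov s x v c) d + eta c (connectionForm cov s x v d)) := by
      rw [covDerivTensor_frame hs.1 hU hx v fun y hy => hgs y hy c d, hgs x hx, hgs x hx]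
    refine (NullQuadruple.isTypeIII_iff hu _).2 ⟨fun b hb w hw => ?_, fun b hb w => ?_⟩ <;>
      obtain ⟨c, rfl⟩ := (s x).surjective b <;> obtain ⟨d, rfl⟩ := (s x).surjective w
    · rw [NullQuadruple.apply_mem_Lam_iff hu, ← eta_kVec_left c] at hb
      rw [NullQuadruple.apply_mem_Lam_iff hu, ← eta_kVec_left d] at hw
      rw [hT, hA.2.1 c d hb hw, neg_zero]
    · obtain ⟨r, rfl⟩ := (NullQuadruple.apply_mem_lam_iff hu c).1 hb
      have h0 : covDerivTensor cov g.toTwoTensor v (s x (r • kVec m)) (s x d) = 0 := by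
        rw [hT, map_smul, eta_smul_left, eta_smul_left, ← mul_add, hA.2.2 d, mul_zero, neg_zero]
      refine ⟨h0, ?_⟩
      rw [← h0]
      exact covDerivTensor_symm cov g v (Y := fun y => s y d)
        (W := fun y => s y (r • kVec m)) ((hs.1.smoothFieldOn d).diffFieldAt hU hx)
        ((hs.1.smoothFieldOn _).diffFieldAt hU hx)

end Main

end KundtGN

theorem mainTheorem10 {m : ℕ} {M : Type*} [TopologicalSpace M] [T2Space M]
    [SecondCountableTopology M] [ChartedSpace (EuclideanSpace ℝ (Fin (m + 2))) M]
    [IsManifold (𝓡 (m + 2)) ∞ M]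
    (P : GStructure (m + 2) M (GN m)) (q : NullQuadruple m M) (hPq : Corresponds P q)
    (g : LorentzMetric m M) (hg : g.BelongsTo P)
    (cov : AffineConnection (m + 2) M) (hcov : CovariantDerivative.ContMDiffCovariantDerivative cov ∞) :
    List.TFAE [
      IsConnectionIn cov P,
      Preserves cov q.lam ∧ Preserves cov q.Lam ∧
        ∀ (x : M) (v : TangentSpace (𝓡 (m + 2)) x),
          q.IsTypeIII (covDerivTensor cov g.toTwoTensor v),
      ∃ (hlam : Preserves cov q.lam) (hLam : Preserves cov q.Lam),
        q.GPerpParallel hLam ∧ q.FParallel hlam] := by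
  tfae_have 1 → 2 := preserves_and_isTypeIII_of_isConnectionIn hPq hg
  tfae_have 2 → 1 := fun ⟨hlam, hLam, hT⟩ => isConnectionIn_of_isTypeIII hPq hg hlam hLam hT
  tfae_have 2 → 3 := fun ⟨hlam, hLam, hT⟩ =>
    ⟨hlam, hLam, (forall_isTypeIII_iff hPq hg hlam hLam).1 hT⟩
  tfae_have 3 → 2 := fun ⟨hlam, hLam, h⟩ =>
    ⟨hlam, hLam, (forall_isTypeIII_iff hPq hg hlam hLam).2 h⟩
  tfae_finish
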